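/- Let $k\ge 2$ and $t\ge 1$ be integers and put $d=tk(k-1)$. Let $\mathbb{K}$ be a field containing a primitive $d$-th root of unity $e$, and let $G=\langle \mathrm{diag}(1,e,e^k)\rangle\subset \mathrm{GL}(3,\mathbb{K})$, acting on $\mathbb{K}[x_0,x_1,x_2]$ by linear substitutions. Let $\mathcal{B}_1$ be the set of monomials of degree $d$ in $x_0,x_1,x_2$ that are invariant under $G$, let $S=\mathbb{K}[w_m : m\in\mathcal{B}_1]$, and let $I(X^G_{2,d})\subset S$ be the toric ideal of $\mathcal{B}_1$, i.e. the kernel of the $\mathbb{K}$-algebra homomorphism $S\to\mathbb{K}[x_0,x_1,x_2]$, $w_m\mapsto m$. Put $I_0=\{0\}$, $I_r=\{(r-1)tk,\,(r-1)tk+1,\,\dots,\,rt(k-1)\}$ for $1\le r\le k$, and $\mathcal{W}_d=\{(r,c) : 0\le r\le k,\ c\in I_r\}$. Then: 1. The map sending $m=x_0^{a}x_1^{b}x_2^{c}\in\mathcal{B}_1$ to $(r,c)$, where $rd=b+kc$, is a well-defined bijection $\mathcal{B}_1\to\mathcal{W}_d$. 2. Order the variables of $S$ by $w_m<w_{m'}$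 if and only if, for the corresponding pairs, $r<r'$, or $r=r'$ and $c<c'$; and let $\preceq$ be the lexicographic term order on $S$ for this order of the variables, so that, for distinct monomials, the smaller one is the one with the smaller exponent at the largest variable where their exponents differ. Then $I(X^G_{2,d})$ has a quadratic Gröbner basis with respect to $\preceq$, that is, a finite Gröbner basis consisting of nonzero homogeneous polynomials of degree $2$. -/

import Mathlib

open MvPolynomial
open scoped MonomialOrder

noncomputable section

/-- The `K`-algebra endomorphism of `K[x_0, …, x_{n-1}]` given by the linear substitution
`x_i ↦ ∑ j, g i j * x_j` attached to `g ∈ GL(n, K)`. -/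
def linearSubst {K : Type*} [Field K] {n : ℕ} (g : GL (Fin n) K) :
    MvPolynomial (Fin n) K →ₐ[K] MvPolynomial (Fin n) K :=
  aeval fun i => ∑ j, C ((g : Matrix (Fin n) (Fin n) K) i j) * X j

/-- `f` is an invariant of the subgroup `G ⊆ GL(n, K)`. -/
def IsInvariantOf {K : Type*} [Field K] {n : ℕ} (G : Subgroup (GL (Fin n) K))
    (f : MvPolynomial (Fin n) K) : Prop :=
  ∀ g ∈ G, linearSubst g f = f

/-- The monomials of degree `d` (represented by their exponent vectors) that are invariants
of `G`. -/
def invariantMonomials {K : Type*} [Field K] {n : ℕ} (G : Subgroup (GL (Fin n) K)) (d : ℕ) :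
    Set (Fin n →₀ ℕ) :=
  {a | a.degree = d ∧ IsInvariantOf G (monomial a (1 : K))}

/-- The toric ideal of a set `Ω` of monomials: the kernel of the `K`-algebra homomorphism
`K[w_m : m ∈ Ω] → K[x_0, …, x_{n-1}]`, `w_m ↦ m`. -/
def toricIdeal (K : Type*) [Field K] {n : ℕ} (Ω : Set (Fin n →₀ ℕ)) :
    Ideal (MvPolynomial Ω K) :=
  RingHom.ker (aeval (R := K) fun m : Ω => monomial (m : Fin n →₀ ℕ) (1 : K))

/-- The invertible diagonal matrix with diagonal entries `v`. -/
def diagGL {K : Type*} [Field K] {n : ℕ} (v : Fin n → Kˣ) : GL (Fin n) K where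
  val := Matrix.diagonal fun i => (v i : K)
  inv := Matrix.diagonal fun i => ((v i)⁻¹ : Kˣ)
  val_inv := by simp
  inv_val := by simp

/-- The cyclic group `⟨diag(1, e, e ^ k)⟩ ⊆ GL(3, K)`. -/
def cyclicGroup01k {K : Type*} [Field K] (e : Kˣ) (k : ℕ) : Subgroup (GL (Fin 3) K) :=
  Subgroup.zpowers (diagGL ![1, e, e ^ k])

/-- The intervals `I_0 = {0}` and `I_r = {(r-1)tk, …, rt(k-1)}` for `r ≥ 1`. -/
def colRange (t k : ℕ) : ℕ → Set ℕ
  | 0 => {0}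
  | r + 1 => Set.Icc (r * t * k) ((r + 1) * t * (k - 1))

/-- The set of pairs `(r, c)` with `0 ≤ r ≤ k` and `c ∈ I_r`; the lexicographic product
`ℕ ×ₗ ℕ` carries the order `(r, c) < (r', c')` iff `r < r'`, or `r = r'` and `c < c'`. -/
def pairSet (t k : ℕ) : Set (ℕ ×ₗ ℕ) :=
  {p | (ofLex p).1 ≤ k ∧ (ofLex p).2 ∈ colRange t k (ofLex p).1}

/-- The monomial order `mo` is the lexicographic term order in which the variables `w_i` are
ordered by the values of `key`, a larger key meaning a larger variable. Thus `w^α < w^β` iff at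
the largest variable where the exponents differ, `α` has the smaller exponent. -/
def IsLexWith {σ ι : Type*} [LT ι] (mo : MonomialOrder σ) (key : σ → ι) : Prop :=
  ∀ α β : σ →₀ ℕ, α ≺[mo] β ↔ ∃ i, (∀ j, key i < key j → α j = β j) ∧ α i < β i

/-- `B` is a Gröbner basis of the ideal `I` with respect to the monomial order `mo`: it is a
finite subset of `I` whose leading terms generate the initial ideal of `I`. -/
def IsGroebnerBasis {K σ : Type*} [Field K] (mo : MonomialOrder σ)
    (I : Ideal (MvPolynomial σ K)) (B : Set (MvPolynomial σ K)) : Prop :=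
  B.Finite ∧ B ⊆ (I : Set (MvPolynomial σ K)) ∧
    Ideal.span (mo.leadingTerm '' B) =
      Ideal.span (mo.leadingTerm '' (I : Set (MvPolynomial σ K)))

/-- `B` consists of quadrics, that is, of nonzero forms of degree two. -/
def IsQuadraticSet {K σ : Type*} [Field K] (B : Set (MvPolynomial σ K)) : Prop :=
  ∀ b ∈ B, b ≠ 0 ∧ b.IsHomogeneous 2

end

/-!
Invariant monomials of degree `d` correspond to the lattice points `(r, c)` of a triangle, and the
exponents are affine functions of `(r, c)`. Hence two monomials of `S` lie in the same fibre of
`w_m ↦ m` exactly when the corresponding multisets of points have the same cardinality and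
the same sum.

A polynomial of the toric ideal has, besides its leading monomial, another monomial in the same
fibre (`exists_mem_support_of_mem_toricIdeal`), so initial monomials are those which are not the
smallest of their fibre. It therefore suffices to show that every such monomial has a quadratic
divisor that is not the smallest of its fibre; the quadratic binomials then form a Gröbner basis
(`exists_quadratic_isGroebnerBasis`).

Two ingredients give this. For `r, s ≥ 1` the set `I_r + I_s` is an interval that depends only on
`r + s`, and it contains `I_0 + I_{r+s}`; so a pair of points can be made smaller unless it is
`Compatible`: the points lie in rows at distance at most one, in neighbouring columns if the rows
agree, and otherwise with the lower point at the right end or the upper point at the left end of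
its row (`exists_smaller_pair`). Conversely, a pairwise compatible multiset is determined by its
cardinality and its sum (`eq_of_compatible`): its rows form a balanced multiset of numbers, which
is unique; of the two rows that occur, the lower one is entirely at its right end or the upper one
is entirely at its left end, which fixes the sum of the columns in each row; and in each row the
columns are balanced again.
-/

open MvPolynomial
open scoped MonomialOrder

/-! ### Lexicographic orders and toric ideals -/

theorem exists_isLexWith {σ : Type} {ι : Type*} [Finite σ] [LinearOrder ι] (key : σ → ι)
    (hkey : Function.Injective key) : ∃ mo : MonomialOrder.{0, 0} σ, IsLexWith mo key := by
  -- Mathlib's lexicographic order treats smaller indices as larger variables, hence the dual order.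
  let : LinearOrder σ := LinearOrder.lift' (fun s => OrderDual.toDual (key s)) fun _ _ h => hkey h
  refine ⟨MonomialOrder.lex, fun α β => ?_⟩
  rw [MonomialOrder.lex_lt_iff, Finsupp.Lex.lt_iff]
  rfl

/-- In a lexicographic order, a quadratic monomial shrinks when both of its variables are replaced
by variables smaller than the larger one of them. -/
theorem IsLexWith.single_add_single_lt {σ ι : Type*} [Preorder ι] {mo : MonomialOrder σ}
    {key : σ → ι} (h : IsLexWith mo key) {x y x' y' : σ} (hyx : key y ≤ key x)
    (hx' : key x' < key x) (hy' : key y' < key x) :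
    Finsupp.single x' 1 + Finsupp.single y' 1 ≺[mo] Finsupp.single x 1 + Finsupp.single y 1 := by
  classical
  rw [h]
  have aux : ∀ {a b : σ}, key a < key b → (Finsupp.single a 1 : σ →₀ ℕ) b = 0 := fun hab =>
    Finsupp.single_eq_of_ne (by rintro rfl; exact lt_irrefl _ hab)
  refine ⟨x, fun j hj => ?_, ?_⟩
  · simp [aux hj, aux (hx'.trans hj), aux (hy'.trans hj), aux (hyx.trans_lt hj)]
  · simp [aux hx', aux hy']

section

variable {K : Type*} [Field K] {n : ℕ} {Ω : Set (Fin n →₀ ℕ)}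

/-- The exponent vector of the image of the monomial `w^α` under `w_m ↦ m`. -/
noncomputable def toricExponent (Ω : Set (Fin n →₀ ℕ)) : (Ω →₀ ℕ) →ₗ[ℕ] (Fin n →₀ ℕ) :=
  Finsupp.linearCombination ℕ Subtype.val

theorem toricExponent_single (x : Ω) : toricExponent Ω (Finsupp.single x 1) = x := by
  simp [toricExponent]

theorem aeval_monomial_eq (α : Ω →₀ ℕ) (c : K) :
    aeval (R := K) (fun m : Ω => monomial (m : Fin n →₀ ℕ) (1 : K)) (monomial α c) =
      monomial (toricExponent Ω α) c := by
  rw [aeval_monomial, toricExponent, Finsupp.linearCombination_apply, monomial_finsupp_sum_index,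
    algebraMap_eq]
  simp [monomial_pow]

theorem monomial_sub_monomial_mem_toricIdeal {α β : Ω →₀ ℕ}
    (h : toricExponent Ω α = toricExponent Ω β) :
    monomial α 1 - monomial β 1 ∈ toricIdeal K Ω := by
  rw [toricIdeal, RingHom.mem_ker, map_sub]
  erw [aeval_monomial_eq, aeval_monomial_eq]
  rw [h, sub_self]

/-- The image of `f` vanishes, so the term of `f` at `α` is cancelled by another term of `f` in the
fibre of `α`. -/
theorem exists_mem_support_of_mem_toricIdeal {f : MvPolynomial Ω K} (hf : f ∈ toricIdeal K Ω)
    {α : Ω →₀ ℕ} (hα : α ∈ f.support) :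
    ∃ β ∈ f.support, β ≠ α ∧ toricExponent Ω β = toricExponent Ω α := by
  classical
  by_contra! hcon
  have h0 : aeval (R := K) (fun m : Ω => monomial (m : Fin n →₀ ℕ) (1 : K)) f = 0 := hf
  rw [f.as_sum, map_sum] at h0
  have h1 := congrArg (coeff (toricExponent Ω α)) h0
  simp only [aeval_monomial_eq, coeff_sum, coeff_monomial, coeff_zero] at h1
  rw [Finset.sum_eq_single_of_mem α hα fun β hβ hne => if_neg (hcon β hβ hne), if_pos rfl] at h1
  exact mem_support_iff.1 hα h1

theorem degree_monomial_sub_monomial {σ : Type*} (mo : MonomialOrder σ) {α β : σ →₀ ℕ}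
    (h : β ≺[mo] α) : mo.degree (monomial α (1 : K) - monomial β 1) = α := by
  classical
  rw [mo.degree_sub_of_lt]
  · simp [mo.degree_monomial]
  · simpa [mo.degree_monomial] using h

theorem leadingTerm_monomial_sub_monomial {σ : Type*} (mo : MonomialOrder σ) {α β : σ →₀ ℕ}
    (h : β ≺[mo] α) : mo.leadingTerm (monomial α (1 : K) - monomial β 1) = monomial α 1 := by
  classical
  rw [MonomialOrder.leadingTerm, degree_monomial_sub_monomial mo h, mo.leadingCoeff_sub_of_lt]
  · simp
  · simpa [mo.degree_monomial] using h

/-- If all incompatible pairs of variables can be replaced by a smaller pair in the same fibre, and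
pairwise compatible monomials are determined by their fibre, then the quadratic binomials form
a Gröbner basis. -/
theorem exists_quadratic_isGroebnerBasis [Finite Ω] (mo : MonomialOrder Ω) (R : Ω → Ω → Prop)
    (hrefl : ∀ x, R x x)
    (hred : ∀ x y, ¬ R x y → ∃ x' y' : Ω, (x' : Fin n →₀ ℕ) + y' = x + y ∧
      Finsupp.single x' 1 + Finsupp.single y' 1 ≺[mo] Finsupp.single x 1 + Finsupp.single y 1)
    (huniq : ∀ α β : Ω →₀ ℕ, toricExponent Ω α = toricExponent Ω β →
      (∀ x ∈ α.support, ∀ y ∈ α.support, R x y) → (∀ x ∈ β.support, ∀ y ∈ β.support, R x y) →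
      α = β) :
    ∃ B : Set (MvPolynomial Ω K), IsQuadraticSet B ∧ IsGroebnerBasis mo (toricIdeal K Ω) B := by
  classical
  let q : Ω → Ω → (Ω →₀ ℕ) := fun x y => Finsupp.single x 1 + Finsupp.single y 1
  have hq : ∀ x y, toricExponent Ω (q x y) = x + y := fun x y => by
    simp [q, toricExponent_single]
  -- A monomial with an incompatible pair is divisible by that pair, which can be exchanged.
  have hpair : ∀ α : Ω →₀ ℕ, ¬ (∀ x ∈ α.support, ∀ y ∈ α.support, R x y) →
      ∃ x y x' y' : Ω, q x y ≤ α ∧ (x' : Fin n →₀ ℕ) + y' = x + y ∧ q x' y' ≺[mo] q x y := by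
    intro α hα
    push Not at hα
    obtain ⟨x, hx, y, hy, hxy⟩ := hα
    obtain ⟨x', y', h1, h2⟩ := hred x y hxy
    refine ⟨x, y, x', y', fun z => ?_, h1, h2⟩
    have hne : x ≠ y := by rintro rfl; exact hxy (hrefl x)
    rw [Finsupp.mem_support_iff] at hx hy
    simp only [q, Finsupp.add_apply, Finsupp.single_apply]
    split_ifs with hxz hyz hyz
    · exact absurd (hxz.trans hyz.symm) hne
    · subst hxz; omega
    · subst hyz; omega
    · omega
  -- A minimal monomial of its fibre is pairwise compatible, so no other monomial of it is.
  have hmin : ∀ α β : Ω →₀ ℕ, toricExponent Ω β = toricExponent Ω α → β ≺[mo] α →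
      ¬ (∀ x ∈ α.support, ∀ y ∈ α.support, R x y) := by
    intro α β hβα hlt hα
    have hwf : WellFounded fun a b : Ω →₀ ℕ => a ≺[mo] b :=
      InvImage.wf mo.toSyn wellFounded_lt
    let S : Set (Ω →₀ ℕ) := {γ | toricExponent Ω γ = toricExponent Ω α}
    have hne : S.Nonempty := ⟨α, rfl⟩
    have hγS : hwf.min S hne ∈ S := hwf.min_mem S hne
    set γ := hwf.min S hne
    by_cases hγ : ∀ x ∈ γ.support, ∀ y ∈ γ.support, R x y
    · exact hwf.not_lt_min S hβα (show β ≺[mo] γ from huniq α γ hγS.symm hα hγ ▸ hlt)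
    · obtain ⟨x, y, x', y', hle, heq, hlt'⟩ := hpair γ hγ
      obtain ⟨δ, hδ⟩ := exists_add_of_le hle
      refine hwf.not_lt_min S (x := q x' y' + δ) ?_ ?_
      · change toricExponent Ω _ = _
        rw [map_add, hq, heq, ← hq, ← map_add, ← hδ]
        exact hγS
      · change _ ≺[mo] γ
        have := add_lt_add_left hlt' (mo.toSyn δ)
        rwa [← map_add, ← map_add, ← hδ] at this
  let B : Set (MvPolynomial Ω K) := {f | ∃ x y x' y' : Ω, (x' : Fin n →₀ ℕ) + y' = x + y ∧
    q x' y' ≺[mo] q x y ∧ f = monomial (q x y) 1 - monomial (q x' y') 1}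
  have hdeg : ∀ x y, (q x y).degree = 2 := fun x y => by simp [q]
  have hBI : B ⊆ (toricIdeal K Ω : Set (MvPolynomial Ω K)) := by
    rintro f ⟨x, y, x', y', heq, -, rfl⟩
    exact monomial_sub_monomial_mem_toricIdeal (by rw [hq, hq, heq])
  refine ⟨B, ?_, ?_, hBI, ?_⟩
  · rintro f ⟨x, y, x', y', -, hlt, rfl⟩
    refine ⟨fun h0 => ?_, (isHomogeneous_monomial _ (hdeg x y)).sub
      (isHomogeneous_monomial _ (hdeg x' y'))⟩
    have := leadingTerm_monomial_sub_monomial (K := K) mo hlt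
    rw [h0, MonomialOrder.leadingTerm_zero] at this
    simpa using this.symm
  · refine (Set.finite_range fun p : Ω × Ω × Ω × Ω =>
      (monomial (q p.1 p.2.1) 1 - monomial (q p.2.2.1 p.2.2.2) 1 : MvPolynomial Ω K)).subset ?_
    rintro f ⟨x, y, x', y', -, -, rfl⟩
    exact ⟨(x, y, x', y'), rfl⟩
  · refine le_antisymm (Ideal.span_mono (Set.image_mono hBI)) (Ideal.span_le.2 ?_)
    rintro _ ⟨f, hf, rfl⟩
    by_cases hf0 : f = 0
    · simp [hf0]
    obtain ⟨β, hβ, hne, hβα⟩ :=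
      exists_mem_support_of_mem_toricIdeal hf (mo.degree_mem_support hf0)
    have hlt : β ≺[mo] mo.degree f :=
      lt_of_le_of_ne (mo.le_degree hβ) fun h => hne (mo.toSyn.injective h)
    obtain ⟨x, y, x', y', hle, heq, hlt'⟩ := hpair _ (hmin _ _ hβα hlt)
    obtain ⟨δ, hδ⟩ := exists_add_of_le hle
    have : mo.leadingTerm f = monomial δ (mo.leadingCoeff f) *
        mo.leadingTerm (monomial (q x y) (1 : K) - monomial (q x' y') 1) := by
      rw [leadingTerm_monomial_sub_monomial mo hlt', monomial_mul, mul_one, add_comm, ← hδ]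
      rfl
    rw [SetLike.mem_coe, this]
    exact Ideal.mul_mem_left _ _ (Ideal.subset_span ⟨_, ⟨x, y, x', y', heq, hlt', rfl⟩, rfl⟩)

end

/-! ### Balanced multisets -/

theorem Multiset.exists_eq_replicate_add_replicate {m : Multiset ℕ} {q : ℕ}
    (h : ∀ x ∈ m, x = q ∨ x = q + 1) :
    ∃ b, m = replicate (m.count q) q + replicate b (q + 1) := by
  refine ⟨m.count (q + 1), Multiset.ext.2 fun x => ?_⟩
  simp only [count_add, count_replicate]
  split_ifs with h1 h2 h2
  · omega
  · simp [h1]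
  · simp [h2]
  · simpa using count_eq_zero.2 fun hx => (h x hx).elim (fun e => h1 e.symm) fun e => h2 e.symm

/-- A multiset of natural numbers that differ pairwise by at most one is determined by its
cardinality and its sum. -/
theorem Multiset.eq_of_balanced {m m' : Multiset ℕ}
    (h : ∀ x ∈ m, ∀ y ∈ m, x ≤ y + 1) (h' : ∀ x ∈ m', ∀ y ∈ m', x ≤ y + 1)
    (hc : card m = card m') (hs : m.sum = m'.sum) : m = m' := by
  -- Both consist of copies of their minimum `q` and of `q + 1`.
  have key : ∀ m : Multiset ℕ, m ≠ 0 → (∀ x ∈ m, ∀ y ∈ m, x ≤ y + 1) → ∃ q a b : ℕ,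
      0 < a ∧ m = replicate a q + replicate b (q + 1) := by
    intro m hm hbal
    obtain ⟨z, hz⟩ := exists_mem_of_ne_zero hm
    classical
    have hex : ∃ q, q ∈ m := ⟨z, hz⟩
    have hq := Nat.find_spec hex
    obtain ⟨b, hb⟩ := exists_eq_replicate_add_replicate (m := m) (q := Nat.find hex) fun x hx => by
      have := hbal x hx _ hq
      have := Nat.find_min' hex hx
      omega
    exact ⟨_, _, b, count_pos.2 hq, hb⟩
  rcases eq_or_ne m 0 with rfl | hm
  · exact (card_eq_zero.1 (by simpa using hc.symm)).symm
  have hm' : m' ≠ 0 := by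
    rintro rfl
    exact hm (card_eq_zero.1 (by simpa using hc))
  obtain ⟨q, a, b, ha, rfl⟩ := key m hm h
  obtain ⟨q', a', b', ha', rfl⟩ := key m' hm' h'
  simp only [card_add, card_replicate, sum_add, sum_replicate, smul_eq_mul] at hc hs
  have hq : q = q' := by
    rcases lt_trichotomy q q' with hlt | heq | hgt
    · obtain ⟨j, rfl⟩ := Nat.exists_eq_add_of_lt hlt
      nlinarith [Nat.zero_le ((a' + b') * j), congrArg (· * q) hc]
    · exact heq
    · obtain ⟨j, rfl⟩ := Nat.exists_eq_add_of_lt hgt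
      nlinarith [Nat.zero_le ((a + b) * j), congrArg (· * q') hc]
  subst hq
  have hb : b = b' := by nlinarith [congrArg (· * q) hc]
  subst hb
  have : a = a' := by omega
  rw [this]

/-! ### The points `(r, c)` -/

/-- A description of `I_r` that is uniform in `r`: for `r = 0` the lower bound is vacuous. -/
theorem mem_colRange_iff {t k r c : ℕ} :
    c ∈ colRange t k r ↔ r * t * k ≤ c + t * k ∧ c ≤ r * t * (k - 1) := by
  cases r with
  | zero => simp only [colRange, Set.mem_singleton_iff]; grind
  | succ r =>
    simp only [colRange, Set.mem_Icc, add_mul, one_mul]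
    omega

/-- Compatibility of two points `(r, c)`: their rows differ by at most one; in a common row, so do
their columns; in consecutive rows, the lower point is at the right end of its row or the upper
point is at the left end of its row. -/
def Compatible (t k : ℕ) (p q : ℕ × ℕ) : Prop :=
  p.1 ≤ q.1 + 1 ∧ q.1 ≤ p.1 + 1 ∧ (p.1 = q.1 → p.2 ≤ q.2 + 1 ∧ q.2 ≤ p.2 + 1) ∧
    (q.1 = p.1 + 1 → p.2 = p.1 * t * (k - 1) ∨ q.2 + t * k = q.1 * t * k) ∧
    (p.1 = q.1 + 1 → q.2 = q.1 * t * (k - 1) ∨ p.2 + t * k = p.1 * t * k)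

theorem Compatible.refl (t k : ℕ) (p : ℕ × ℕ) : Compatible t k p p := by
  simp [Compatible]

theorem Compatible.symm {t k : ℕ} {p q : ℕ × ℕ} (h : Compatible t k p q) :
    Compatible t k q p :=
  ⟨h.2.1, h.1, fun e => (h.2.2.1 e.symm).symm, h.2.2.2.2, h.2.2.2.1⟩

/-- An incompatible pair can be replaced by a pair with the same sum, both members of which precede
the larger point of the given pair: points in distant rows move to the adjacent inner rows, and
points in the same row or in consecutive rows move one column towards, respectively away from,
each other. -/
theorem exists_smaller_pair {t k : ℕ} {p q : ℕ × ℕ} (hpk : p.1 ≤ k) (hqk : q.1 ≤ k)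
    (hp : p.2 ∈ colRange t k p.1) (hq : q.2 ∈ colRange t k q.1)
    (hle : toLex q ≤ toLex p) (h : ¬ Compatible t k p q) :
    ∃ p' q' : ℕ × ℕ, (p'.1 ≤ k ∧ p'.2 ∈ colRange t k p'.1) ∧
      (q'.1 ≤ k ∧ q'.2 ∈ colRange t k q'.1) ∧
      toLex p' < toLex p ∧ toLex q' < toLex p ∧ p' + q' = p + q := by
  obtain ⟨r, c⟩ := p
  obtain ⟨s, b⟩ := q
  simp only [Prod.Lex.le_iff, Prod.Lex.lt_iff, ofLex_toLex, mem_colRange_iff, Compatible,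
    Prod.mk_add_mk] at *
  obtain ⟨hp1, hp2⟩ := hp
  obtain ⟨hq1, hq2⟩ := hq
  by_cases hfar : s + 2 ≤ r
  · obtain ⟨j, rfl⟩ := Nat.exists_eq_add_of_le hfar
    -- The two new rows are `s + 1` and `s + 1 + j`; the columns are found one after the other.
    have hlen : ∀ i, i + 1 ≤ k → i * t * k ≤ (i + 1) * t * (k - 1) := by
      intro i hi
      obtain ⟨l, rfl⟩ := Nat.exists_eq_add_of_le hi
      have : i + 1 + l - 1 = i + l := by omega
      rw [this]
      nlinarith [Nat.zero_le (t * l)]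
    have l1 := hlen s (by omega)
    have l2 := hlen (s + j) (by omega)
    have e1 : (s + 2 + j) * t * k = s * t * k + j * t * k + 2 * (t * k) := by ring
    have e2 : (s + 2 + j) * t * (k - 1)
      = s * t * (k - 1) + j * t * (k - 1) + 2 * (t * (k - 1)) := by ring
    have e3 : (s + j) * t * k = s * t * k + j * t * k := by ring
    have e4 : (s + j + 1) * t * (k - 1) = s * t * (k - 1) + j * t * (k - 1) + t * (k - 1) := by ring
    have e5 : (s + 1) * t * (k - 1) = s * t * (k - 1) + t * (k - 1) := by ring
    have e6 : (s + j + 1) * t * k = s * t * k + j * t * k + t * k := by ring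
    have e7 : (s + 1) * t * k = s * t * k + t * k := by ring
    obtain ⟨u, v, hu1, hu2, hv1, hv2, huv⟩ : ∃ u v, s * t * k ≤ u ∧ u ≤ (s + 1) * t * (k - 1) ∧
        (s + j) * t * k ≤ v ∧ v ≤ (s + j + 1) * t * (k - 1) ∧ u + v = c + b := by
      have hsum1 : s * t * k + (s + j) * t * k ≤ c + b := by
        rcases Nat.eq_zero_or_pos s with rfl | hs
        · simp only [zero_mul] at *; omega
        · omega
      by_cases hcase : c + b ≤ s * t * k + (s + j + 1) * t * (k - 1)
      · exact ⟨s * t * k, c + b - s * t * k, by omega, by omega, by omega, by omega, by omega⟩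
      · exact ⟨c + b - (s + j + 1) * t * (k - 1), (s + j + 1) * t * (k - 1), by omega, by omega,
          by omega, by omega, by omega⟩
    refine ⟨(s + j + 1, v), (s + 1, u), ?_⟩
    dsimp only
    rw [Prod.mk_add_mk, Prod.mk.injEq]
    omega
  rcases (by omega : r = s ∨ r = s + 1) with rfl | rfl
  · refine ⟨(r, c - 1), (r, b + 1), ?_⟩
    dsimp only
    rw [Prod.mk_add_mk, Prod.mk.injEq]
    omega
  · refine ⟨(s + 1, c - 1), (s, b + 1), ?_⟩
    have e7 : (s + 1) * t * k = s * t * k + t * k := by ring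
    dsimp only
    rw [Prod.mk_add_mk, Prod.mk.injEq]
    omega

/-- The columns of the points of `M` in row `r`. -/
def rowColumns (M : Multiset (ℕ × ℕ)) (r : ℕ) : Multiset ℕ :=
  (M.filter fun p => p.1 = r).map Prod.snd

theorem mem_rowColumns {M : Multiset (ℕ × ℕ)} {r c : ℕ} : c ∈ rowColumns M r ↔ (r, c) ∈ M := by
  simp only [rowColumns, Multiset.mem_map, Multiset.mem_filter, Prod.exists]
  grind

theorem card_rowColumns (M : Multiset (ℕ × ℕ)) (r : ℕ) :
    (rowColumns M r).card = (M.map Prod.fst).count r := by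
  rw [rowColumns, Multiset.card_map, Multiset.count_map]
  simp only [eq_comm]

theorem count_rowColumns (M : Multiset (ℕ × ℕ)) (p : ℕ × ℕ) :
    (rowColumns M p.1).count p.2 = M.count p := by
  rw [rowColumns, Multiset.count_map, Multiset.filter_filter, Multiset.count,
    Multiset.countP_eq_card_filter]
  congr 1
  refine Multiset.filter_congr fun q _ => ?_
  rw [Prod.ext_iff]
  tauto

theorem sum_rowColumns_add {M : Multiset (ℕ × ℕ)} {s : ℕ}
    (h : ∀ p ∈ M, p.1 = s ∨ p.1 = s + 1) :
    (rowColumns M s).sum + (rowColumns M (s + 1)).sum = (M.map Prod.snd).sum := by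
  rw [← Multiset.filter_add_not (fun p : ℕ × ℕ => p.1 = s) M, Multiset.map_add, Multiset.sum_add]
  simp only [Multiset.filter_add_not]
  congr 2
  rw [rowColumns]
  congr 1
  refine Multiset.filter_congr fun p hp => ?_
  have := h p hp
  omega

/-- For pairwise compatible points in two consecutive rows, either the lower row is as far to the
right or the upper row is as far to the left as possible. -/
theorem sum_rowColumns_extremal {t k s : ℕ} {M : Multiset (ℕ × ℕ)}
    (hcol : ∀ p ∈ M, p.2 ∈ colRange t k p.1) (hcomp : ∀ p ∈ M, ∀ q ∈ M, Compatible t k p q) :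
    (rowColumns M s).sum ≤ (rowColumns M s).card * (s * t * (k - 1)) ∧
    (rowColumns M (s + 1)).card * (s * t * k) ≤ (rowColumns M (s + 1)).sum ∧
    ((rowColumns M s).sum = (rowColumns M s).card * (s * t * (k - 1)) ∨
      (rowColumns M (s + 1)).sum = (rowColumns M (s + 1)).card * (s * t * k)) := by
  have e : (s + 1) * t * k = s * t * k + t * k := by ring
  refine ⟨Multiset.sum_le_card_nsmul _ _ fun c hc => ?_,
    Multiset.card_nsmul_le_sum fun c hc => ?_, ?_⟩
  · exact (mem_colRange_iff.1 (hcol _ (mem_rowColumns.1 hc))).2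
  · have := (mem_colRange_iff.1 (hcol _ (mem_rowColumns.1 hc))).1
    dsimp only at this
    omega
  · by_cases hU : ∀ c ∈ rowColumns M s, c = s * t * (k - 1)
    · left
      conv_lhs => rw [Multiset.eq_replicate_card.2 hU]
      simp
    · right
      push Not at hU
      obtain ⟨c, hc, hne⟩ := hU
      have hL : ∀ b ∈ rowColumns M (s + 1), b = s * t * k := fun b hb => by
        have := ((hcomp _ (mem_rowColumns.1 hc) _ (mem_rowColumns.1 hb)).2.2.2.1 rfl).resolve_left
          hne
        dsimp only at this
        omega
      conv_lhs => rw [Multiset.eq_replicate_card.2 hL]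
      simp

/-- A multiset of pairwise compatible points is determined by its cardinality and its sum. -/
theorem eq_of_compatible {t k : ℕ} {M M' : Multiset (ℕ × ℕ)}
    (hcol : ∀ p ∈ M, p.2 ∈ colRange t k p.1) (hcomp : ∀ p ∈ M, ∀ q ∈ M, Compatible t k p q)
    (hcol' : ∀ p ∈ M', p.2 ∈ colRange t k p.1) (hcomp' : ∀ p ∈ M', ∀ q ∈ M', Compatible t k p q)
    (hcard : M.card = M'.card) (hfst : (M.map Prod.fst).sum = (M'.map Prod.fst).sum)
    (hsnd : (M.map Prod.snd).sum = (M'.map Prod.snd).sum) : M = M' := by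
  have hrows : M.map Prod.fst = M'.map Prod.fst := by
    refine Multiset.eq_of_balanced ?_ ?_ (by simpa using hcard) hfst
    · simp only [Multiset.mem_map]
      rintro _ ⟨p, hp, rfl⟩ _ ⟨q, hq, rfl⟩
      exact (hcomp p hp q hq).1
    · simp only [Multiset.mem_map]
      rintro _ ⟨p, hp, rfl⟩ _ ⟨q, hq, rfl⟩
      exact (hcomp' p hp q hq).1
  have hcards : ∀ r, (rowColumns M r).card = (rowColumns M' r).card := fun r => by
    rw [card_rowColumns, card_rowColumns, hrows]
  rcases eq_or_ne M 0 with rfl | hM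
  · exact (Multiset.card_eq_zero.1 (by simpa using hcard.symm)).symm
  obtain ⟨s, hs⟩ : ∃ s, ∀ r ∈ M.map Prod.fst, r = s ∨ r = s + 1 := by
    obtain ⟨z, hz⟩ := Multiset.exists_mem_of_ne_zero hM
    have hex : ∃ s, s ∈ M.map Prod.fst := ⟨_, Multiset.mem_map_of_mem _ hz⟩
    refine ⟨Nat.find hex, fun r hr => ?_⟩
    have h1 := Nat.find_min' hex hr
    obtain ⟨q, hq, hqs⟩ := Multiset.mem_map.1 (Nat.find_spec hex)
    obtain ⟨p, hp, rfl⟩ := Multiset.mem_map.1 hr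
    have h2 := (hcomp p hp q hq).1
    omega
  -- The extremality conditions and the common total fix the column sums of rows `s`, `s + 1`.
  have hM1 := sum_rowColumns_add fun p hp => hs _ (Multiset.mem_map_of_mem _ hp)
  have hM2 := sum_rowColumns_add (M := M') fun p hp => hs _ (hrows ▸ Multiset.mem_map_of_mem _ hp)
  have hE1 := sum_rowColumns_extremal (s := s) hcol hcomp
  have hE2 := sum_rowColumns_extremal (s := s) hcol' hcomp'
  rw [← hcards, ← hcards] at hE2
  have hrow : ∀ r, rowColumns M r = rowColumns M' r := fun r => by
    refine Multiset.eq_of_balanced (fun c hc b hb => ?_) (fun c hc b hb => ?_) (hcards r) ?_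
    · exact ((hcomp _ (mem_rowColumns.1 hc) _ (mem_rowColumns.1 hb)).2.2.1 rfl).1
    · exact ((hcomp' _ (mem_rowColumns.1 hc) _ (mem_rowColumns.1 hb)).2.2.1 rfl).1
    by_cases hr : r = s ∨ r = s + 1
    · rcases hr with rfl | rfl <;> omega
    · have h0 : (rowColumns M r).card = 0 := by
        rw [card_rowColumns]
        exact Multiset.count_eq_zero.2 fun h => hr (hs r h)
      rw [Multiset.card_eq_zero.1 h0, Multiset.card_eq_zero.1 ((hcards r).symm.trans h0)]
  refine Multiset.ext.2 fun p => ?_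
  rw [← count_rowColumns, ← count_rowColumns, hrow]

/-! ### The invariant monomials -/

theorem linearSubst_diagGL_monomial {K : Type*} [Field K] {n : ℕ} (v : Fin n → Kˣ)
    (a : Fin n →₀ ℕ) (c : K) :
    linearSubst (diagGL v) (monomial a c) = monomial a ((∏ i, (v i : K) ^ a i) * c) := by
  have hX : ∀ i, (∑ j, C ((diagGL v : Matrix (Fin n) (Fin n) K) i j) * X j :
      MvPolynomial (Fin n) K) = C (v i : K) * X i := fun i => by
    rw [Finset.sum_eq_single i]
    · simp [diagGL]
    · intro j _ hj
      simp [diagGL, Matrix.diagonal_apply_ne' _ hj]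
    · simp
  rw [linearSubst, aeval_monomial, Finsupp.prod_fintype _ _ fun i => pow_zero _]
  simp only [hX, mul_pow, Finset.prod_mul_distrib]
  rw [monomial_eq, Finsupp.prod_fintype _ _ fun i => pow_zero _, algebraMap_eq, C_mul, map_prod]
  simp only [C_pow]
  ring

theorem diagGL_zpow {K : Type*} [Field K] {n : ℕ} (v : Fin n → Kˣ) (z : ℤ) :
    diagGL v ^ z = diagGL (v ^ z) := by
  let f : (Fin n → Kˣ) →* GL (Fin n) K := MonoidHom.mk' diagGL fun v w => by
    ext i j
    rcases eq_or_ne i j with rfl | hij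
    · simp [diagGL]
    · simp [diagGL, hij]
  exact (map_zpow f v z).symm

theorem mem_invariantMonomials_iff {K : Type*} [Field K] {k d : ℕ} {e : Kˣ}
    (he : IsPrimitiveRoot (e : K) d) {a : Fin 3 →₀ ℕ} :
    a ∈ invariantMonomials (cyclicGroup01k e k) d ↔
      a 0 + a 1 + a 2 = d ∧ d ∣ a 1 + k * a 2 := by
  have hdeg : a.degree = a 0 + a 1 + a 2 := by
    rw [Finsupp.degree_eq_sum, Fin.sum_univ_three]
  have hprod : ∏ i, ((![1, e, e ^ k] : Fin 3 → Kˣ) i) ^ a i = e ^ (a 1 + k * a 2) := by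
    simp [Fin.prod_univ_three, pow_add, pow_mul]
  have hcoe : ∀ v : Fin 3 → Kˣ, ∏ i, (v i : K) ^ a i = ((∏ i, v i ^ a i : Kˣ) : K) := by
    simp
  have he' : IsPrimitiveRoot e d := IsPrimitiveRoot.coe_units_iff.1 he
  rw [invariantMonomials, Set.mem_ofPred_eq, hdeg]
  refine and_congr_right fun _ => ?_
  rw [← he'.pow_eq_one_iff_dvd, ← hprod]
  constructor
  · intro h
    have := h _ (Subgroup.mem_zpowers _)
    rw [linearSubst_diagGL_monomial, mul_one, hcoe] at this
    exact Units.ext (by simpa using congrArg (coeff a) this)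
  · rintro h _ ⟨z, rfl⟩
    dsimp only
    rw [diagGL_zpow, linearSubst_diagGL_monomial, mul_one, hcoe]
    have hz : ∏ i, ((![1, e, e ^ k] : Fin 3 → Kˣ) ^ z) i ^ a i =
        (∏ i, ((![1, e, e ^ k] : Fin 3 → Kˣ) i) ^ a i) ^ z := by
      rw [← Finset.prod_zpow]
      refine Finset.prod_congr rfl fun i _ => ?_
      rw [Pi.pow_apply]
      generalize (![1, e, e ^ k] : Fin 3 → Kˣ) i = u
      rw [← zpow_natCast, ← zpow_natCast, ← zpow_mul, ← zpow_mul, mul_comm]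
    rw [hz, h, one_zpow, Units.val_one]

/-- The conditions `0 ≤ a`, `0 ≤ b` on the exponents of `x_0` and `x_1`, written in terms of
the row `r` and the column `c`. -/
theorem row_column_bounds {t k d r a b c : ℕ} (ht : 1 ≤ t) (hk : 2 ≤ k) (hd : d = t * k * (k - 1))
    (hdeg : a + b + c = d) (hr : r * d = b + k * c) : r ≤ k ∧ c ∈ colRange t k r := by
  obtain ⟨l, rfl⟩ := Nat.exists_eq_add_of_le' (show 1 ≤ k by omega)
  rw [Nat.add_sub_cancel] at hd
  have hl : 0 < l := by omega
  have hd0 : 0 < d := hd ▸ by positivity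
  rw [mem_colRange_iff, Nat.add_sub_cancel]
  refine ⟨?_, ?_, ?_⟩
  · refine Nat.le_of_mul_le_mul_right ?_ hd0
    rw [hr, ← hdeg]
    nlinarith [Nat.zero_le (l * b), Nat.zero_le ((l + 1) * a)]
  · refine Nat.le_of_mul_le_mul_right ?_ hl
    have : r * t * (l + 1) * l = r * d := by rw [hd]; ring
    rw [this, hr]
    nlinarith
  · refine Nat.le_of_mul_le_mul_left ?_ (Nat.succ_pos l)
    have : (l + 1) * (r * t * l) = r * d := by rw [hd]; ring
    rw [this, hr, Nat.succ_eq_add_one]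
    omega

theorem exists_exponents {t k d r c : ℕ} (hk : 2 ≤ k) (hd : d = t * k * (k - 1))
    (hc : c ∈ colRange t k r) : ∃ a b, a + b + c = d ∧ r * d = b + k * c := by
  obtain ⟨l, rfl⟩ := Nat.exists_eq_add_of_le' (show 1 ≤ k by omega)
  rw [mem_colRange_iff, Nat.add_sub_cancel] at hc
  rw [Nat.add_sub_cancel] at hd
  obtain ⟨h1, h2⟩ := hc
  have e1 : r * t * (l + 1) * l = r * d := by rw [hd]; ring
  have e2 : (l + 1) * (r * t * l) = r * d := by rw [hd]; ring
  have h3 := Nat.mul_le_mul_right l h1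
  have h4 := Nat.mul_le_mul_left (l + 1) h2
  have e3 : (c + t * (l + 1)) * l = c * l + d := by rw [hd]; ring
  have e4 : (l + 1) * c = c * l + c := by ring
  rw [e1, e3] at h3
  rw [e2, e4] at h4
  exact ⟨d - (r * d - (c * l + c)) - c, r * d - (c * l + c), by omega, by omega⟩

theorem exists_equiv_pairSet {K : Type*} [Field K] {t k d : ℕ} (ht : 1 ≤ t) (hk : 2 ≤ k)
    (hd : d = t * k * (k - 1)) {e : Kˣ} (he : IsPrimitiveRoot (e : K) d) :
    ∃ φ : invariantMonomials (cyclicGroup01k e k) d ≃ pairSet t k,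
      ∀ m : invariantMonomials (cyclicGroup01k e k) d,
        (ofLex (φ m).1).1 * d = m.1 1 + k * m.1 2 ∧ (ofLex (φ m).1).2 = m.1 2 := by
  have hd0 : 0 < d := by
    have : 0 < k - 1 := by omega
    rw [hd]; positivity
  have hrow : ∀ m : invariantMonomials (cyclicGroup01k e k) d,
      (m.1 1 + k * m.1 2) / d * d = m.1 1 + k * m.1 2 := fun m =>
    Nat.div_mul_cancel ((mem_invariantMonomials_iff he).1 m.2).2
  let f : invariantMonomials (cyclicGroup01k e k) d → pairSet t k := fun m =>
    ⟨toLex ((m.1 1 + k * m.1 2) / d, m.1 2),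
      row_column_bounds ht hk hd ((mem_invariantMonomials_iff he).1 m.2).1 (hrow m)⟩
  refine ⟨Equiv.ofBijective f ⟨fun m m' h => ?_, fun p => ?_⟩, fun m => ⟨hrow m, rfl⟩⟩
  · have h' := congrArg (fun p => ofLex p.1) h
    simp only [f, ofLex_toLex, Prod.mk.injEq] at h'
    obtain ⟨h1, h2⟩ := h'
    have h3 := hrow m
    rw [h1, hrow m', h2] at h3
    have h4 := ((mem_invariantMonomials_iff he).1 m.2).1
    have h5 := ((mem_invariantMonomials_iff he).1 m'.2).1
    refine Subtype.ext (Finsupp.ext fun i => ?_)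
    fin_cases i <;> dsimp <;> omega
  · obtain ⟨p, hr, hc⟩ := p
    obtain ⟨⟨r, c⟩, rfl⟩ := toLex.surjective p
    obtain ⟨a, b, h1, h2⟩ := exists_exponents hk hd hc
    change a + b + c = d at h1
    change r * d = b + k * c at h2
    refine ⟨⟨Finsupp.equivFunOnFinite.symm ![a, b, c], (mem_invariantMonomials_iff he).2 ?_⟩, ?_⟩
    · simp [h1, ← h2]
    · refine Subtype.ext ?_
      simp only [f, Finsupp.equivFunOnFinite_symm_apply_apply]
      simp [← h2, hd0]

theorem toricExponent_eq_sum {n : ℕ} {Ω : Set (Fin n →₀ ℕ)} (α : Ω →₀ ℕ) :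
    toricExponent Ω α = (α.toMultiset.map Subtype.val).sum := by
  induction α using Finsupp.induction_linear with
  | zero => simp
  | add f g hf hg => simp [hf, hg]
  | single x m => simp [toricExponent, Multiset.map_nsmul, Multiset.sum_nsmul]

theorem toricExponent_apply {n : ℕ} {Ω : Set (Fin n →₀ ℕ)} (α : Ω →₀ ℕ) (i : Fin n) :
    toricExponent Ω α i = (α.toMultiset.map fun m => m.1 i).sum := by
  rw [toricExponent_eq_sum]
  simpa using map_multiset_sum (Finsupp.applyAddHom i) (α.toMultiset.map Subtype.val)

/-! ### The quadratic Gröbner basis -/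

theorem proposition4p9 {K : Type*} [Field K] (t k d : ℕ) (ht : 1 ≤ t) (hk : 2 ≤ k)
    (hd : d = t * k * (k - 1)) (e : Kˣ) (he : IsPrimitiveRoot (e : K) d) :
    ∃ φ : invariantMonomials (cyclicGroup01k e k) d ≃ pairSet t k,
      (∀ m : invariantMonomials (cyclicGroup01k e k) d,
        (ofLex (φ m).1).1 * d = m.1 1 + k * m.1 2 ∧ (ofLex (φ m).1).2 = m.1 2) ∧
      ∃ mo : MonomialOrder.{0, 0} (invariantMonomials (cyclicGroup01k e k) d),
        IsLexWith mo φ ∧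
        ∃ B : Set (MvPolynomial (invariantMonomials (cyclicGroup01k e k) d) K),
          IsQuadraticSet B ∧
          IsGroebnerBasis mo (toricIdeal K (invariantMonomials (cyclicGroup01k e k) d)) B := by
  obtain ⟨φ, hφ⟩ := exists_equiv_pairSet ht hk hd he
  have hdeg : ∀ m : invariantMonomials (cyclicGroup01k e k) d, m.1 0 + m.1 1 + m.1 2 = d := fun m =>
    ((mem_invariantMonomials_iff he).1 m.2).1
  generalize invariantMonomials (cyclicGroup01k e k) d = Ω at *
  have hd0 : 0 < d := by
    have : 0 < k - 1 := by omega
    rw [hd]; positivity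
  have : Finite Ω := by
    refine Set.Finite.subset (Finset.finite_toSet (Finset.finsuppAntidiag Finset.univ d)) ?_
    intro m hm
    have := hdeg ⟨m, hm⟩
    simpa [Finset.mem_finsuppAntidiag, Fin.sum_univ_three] using this
  obtain ⟨mo, hmo⟩ := exists_isLexWith φ φ.injective
  refine ⟨φ, hφ, mo, hmo, ?_⟩
  let pt : Ω → ℕ × ℕ := fun m => ofLex (φ m).1
  have hpt : Function.Injective pt := fun m m' h =>
    φ.injective (Subtype.ext (ofLex.injective h))
  have hptmem : ∀ m, (pt m).1 ≤ k ∧ (pt m).2 ∈ colRange t k (pt m).1 := fun m => (φ m).2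
  have hsurj : ∀ p : ℕ × ℕ, p.1 ≤ k ∧ p.2 ∈ colRange t k p.1 → ∃ m, pt m = p := fun p hp =>
    ⟨φ.symm ⟨toLex p, hp⟩, by simp [pt]⟩
  refine exists_quadratic_isGroebnerBasis mo (fun x y => Compatible t k (pt x) (pt y))
    (fun x => Compatible.refl t k _) ?_ ?_
  · have main : ∀ x y : Ω, φ y ≤ φ x → ¬ Compatible t k (pt x) (pt y) → ∃ x' y' : Ω,
        (x' : Fin 3 →₀ ℕ) + y' = x + y ∧
        Finsupp.single x' 1 + Finsupp.single y' 1 ≺[mo] Finsupp.single x 1 + Finsupp.single y 1 := by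
      intro x y hyx hxy
      obtain ⟨p, q, hp, hq, hpx, hqx, hsum⟩ := exists_smaller_pair (hptmem x).1 (hptmem y).1
        (hptmem x).2 (hptmem y).2 hyx hxy
      obtain ⟨x', rfl⟩ := hsurj p hp
      obtain ⟨y', rfl⟩ := hsurj q hq
      refine ⟨x', y', ?_, hmo.single_add_single_lt hyx hpx hqx⟩
      -- The exponents are affine functions of the point `(r, c)`.
      have hr : ((pt x').1 + (pt y').1) * d = ((pt x).1 + (pt y).1) * d :=
        congrArg (fun p : ℕ × ℕ => p.1 * d) hsum
      have hc : (pt x').2 + (pt y').2 = (pt x).2 + (pt y).2 := congrArg Prod.snd hsum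
      simp only [pt, add_mul, hφ] at hr hc
      have hkc : k * x'.1 2 + k * y'.1 2 = k * x.1 2 + k * y.1 2 := by
        rw [← mul_add, hc, mul_add]
      have h1 := hdeg x
      have h2 := hdeg y
      have h3 := hdeg x'
      have h4 := hdeg y'
      ext i
      fin_cases i <;> dsimp <;> omega
    intro x y hxy
    rcases le_total (φ y) (φ x) with h | h
    · exact main x y h hxy
    · obtain ⟨x', y', h1, h2⟩ := main y x h fun h => hxy h.symm
      exact ⟨x', y', by rw [h1, add_comm], by rwa [add_comm (Finsupp.single x 1)]⟩
  · intro α β hαβ hα hβ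
    classical
    refine Multiset.toFinsupp.symm.injective (Multiset.map_injective hpt ?_)
    change α.toMultiset.map pt = β.toMultiset.map pt
    have hcol : ∀ α : Ω →₀ ℕ, ∀ p ∈ α.toMultiset.map pt, p.2 ∈ colRange t k p.1 := by
      simp only [Multiset.mem_map]
      rintro α _ ⟨m, -, rfl⟩
      exact (hptmem m).2
    have hcomp : ∀ α : Ω →₀ ℕ,
        (∀ x ∈ α.support, ∀ y ∈ α.support, Compatible t k (pt x) (pt y)) →
        ∀ p ∈ α.toMultiset.map pt, ∀ q ∈ α.toMultiset.map pt, Compatible t k p q := by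
      simp only [Multiset.mem_map, Finsupp.mem_toMultiset]
      rintro α h _ ⟨x, hx, rfl⟩ _ ⟨y, hy, rfl⟩
      exact h x hx y hy
    have hcard : ∀ α : Ω →₀ ℕ, α.toMultiset.card * d =
        toricExponent Ω α 0 + toricExponent Ω α 1 + toricExponent Ω α 2 := fun α => by
      simp only [toricExponent_apply, ← Multiset.sum_map_add, hdeg]
      simp
    have hfst : ∀ α : Ω →₀ ℕ, ((α.toMultiset.map pt).map Prod.fst).sum * d =
        toricExponent Ω α 1 + k * toricExponent Ω α 2 := fun α => by
      rw [toricExponent_apply, toricExponent_apply, ← Multiset.sum_map_mul_left,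
        ← Multiset.sum_map_add, Multiset.map_map, ← Multiset.sum_map_mul_right]
      exact congrArg Multiset.sum (Multiset.map_congr rfl fun m _ => (hφ m).1)
    have hsnd : ∀ α : Ω →₀ ℕ, ((α.toMultiset.map pt).map Prod.snd).sum =
        toricExponent Ω α 2 := fun α => by
      rw [toricExponent_apply, Multiset.map_map]
      exact congrArg Multiset.sum (Multiset.map_congr rfl fun m _ => (hφ m).2)
    refine eq_of_compatible (hcol α) (hcomp α hα) (hcol β) (hcomp β hβ) ?_ ?_ ?_
    · rw [Multiset.card_map, Multiset.card_map]
      exact Nat.eq_of_mul_eq_mul_right hd0 (by rw [hcard, hcard, hαβ])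
    · exact Nat.eq_of_mul_eq_mul_right hd0 (by rw [hfst, hfst, hαβ])
    · rw [hsnd, hsnd, hαβ]
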